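/- Let $\mathcal D$ be a division ring, let $\tau$ be an automorphism of $\mathcal D$ of infinite inner order (that is, for no integer $m\ge 1$ is $\tau^m$ an inner automorphism $d\mapsto a^{-1}da$, $a\in\mathcal D\setminus\{0\}$), and let $R=\mathcal D[t^{\pm1};\tau]$ be the skew Laurent polynomial ring, whose elements are the finite sums $\sum_{i\in\mathbb Z} d_it^i$ with $d_i\in\mathcal D$ and whose multiplication is determined by $td=\tau(d)t$ for $d\in\mathcal D$. A Sylvester (matrix) rank function on a ring $S$ is a map $\mathrm{rk}$ assigning to each rectangular matrix over $S$ a non-negative real number such that (1) $\mathrm{rk}(0)=0$ for every zero matrix and $\mathrm{rk}(1)=1$; (2) $\mathrm{rk}(AB)\le\min\{\mathrm{rk}(A),\mathrm{rk}(B)\}$ whenever $AB$ is defined; (3) $\mathrm{rk}\begin{pmatrix}A&0\\0&B\end{pmatrix}=\mathrm{rk}(A)+\mathrm{rk}(B)$; (4) $\mathrm{rk}\begin{pmatrix}A&C\\0&B\end{pmatrix}\ge\mathrm{rk}(A)+\mathrm{rk}(B)$ for $A,B,C$ of appropriate sizes. Then the centre $Z(R)$ is a field; the set of non-zero-divisors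 of $R$ satisfies the left Ore condition, so that the Ore quotient ring $Q$ of $R$ (the left ring of fractions of $R$ with respect to all non-zero-divisors) exists; and the following hold. (i) There is exactly one Sylvester rank function $\mathrm{rk}_Q$ on $Q$, namely the usual matrix rank, $\mathrm{rk}_Q(A)=$ the dimension of the left $Q$-span of the rows of $A$. (ii) There is exactly one Sylvester rank function $\mathrm{rk}_R$ on $R$, namely the one induced from $Q$: $\mathrm{rk}_R(A)=\mathrm{rk}_Q(\varphi(A))$ for every matrix $A$ over $R$, where $\varphi:R\to Q$ is the canonical homomorphism. (iii) There is exactly one Sylvester rank function $\mathrm{rk}_Z$ on the field $Z(R)$, namely the usual matrix rank, and $\mathrm{rk}_R$ extends it: $\mathrm{rk}_R(A)=\mathrm{rk}_Z(A)$ for every matrix $A$ over $Z(R)$. -/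

import Mathlib

/-- A Sylvester matrix rank function on a ring `R`: a nonnegative real number for every
rectangular matrix over `R` (of any size), subject to the four standard axioms. Block matrices
are re-indexed from `Fin m ⊕ Fin p` to `Fin (m + p)`. -/
@[ext]
structure SylvesterRank (R : Type*) [Ring R] where
  rk : ∀ {m n : ℕ}, Matrix (Fin m) (Fin n) R → ℝ
  rk_nonneg : ∀ {m n : ℕ} (A : Matrix (Fin m) (Fin n) R), 0 ≤ rk A
  rk_zero : ∀ m n : ℕ, rk (0 : Matrix (Fin m) (Fin n) R) = 0
  rk_one : rk (1 : Matrix (Fin 1) (Fin 1) R) = 1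
  rk_mul_le : ∀ {l m n : ℕ} (A : Matrix (Fin l) (Fin m) R) (B : Matrix (Fin m) (Fin n) R),
    rk (A * B) ≤ min (rk A) (rk B)
  rk_diag : ∀ {m n p q : ℕ} (A : Matrix (Fin m) (Fin n) R) (B : Matrix (Fin p) (Fin q) R),
    rk (Matrix.reindex finSumFinEquiv finSumFinEquiv (Matrix.fromBlocks A 0 0 B)) = rk A + rk B
  rk_triangular : ∀ {m n p q : ℕ} (A : Matrix (Fin m) (Fin n) R) (B : Matrix (Fin p) (Fin q) R)
    (C : Matrix (Fin m) (Fin q) R),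
    rk A + rk B ≤ rk (Matrix.reindex finSumFinEquiv finSumFinEquiv (Matrix.fromBlocks A C 0 B))

/-- The rank function on `R` induced from one on `S` by a ring homomorphism `φ : R → S`:
a matrix `A` over `R` gets the rank of `φ(A)`. If `φ` is an inclusion this is restriction. -/
def SylvesterRank.comap {R S : Type*} [Ring R] [Ring S] (φ : R →+* S) (r : SylvesterRank S) :
    SylvesterRank R where
  rk A := r.rk (A.map φ)
  rk_nonneg A := r.rk_nonneg _
  rk_zero m n := by
    rw [Matrix.map_zero _ (map_zero φ)]
    exact r.rk_zero m n
  rk_one := by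
    rw [Matrix.map_one _ (map_zero φ) (map_one φ)]
    exact r.rk_one
  rk_mul_le A B := by
    rw [Matrix.map_mul]
    exact r.rk_mul_le _ _
  rk_diag A B := by
    rw [Matrix.reindex_apply, ← Matrix.submatrix_map, Matrix.fromBlocks_map,
      Matrix.map_zero _ (map_zero φ), Matrix.map_zero _ (map_zero φ)]
    exact r.rk_diag _ _
  rk_triangular A B C := by
    rw [Matrix.reindex_apply, ← Matrix.submatrix_map, Matrix.fromBlocks_map,
      Matrix.map_zero _ (map_zero φ)]
    exact r.rk_triangular _ _ _

/-- The row rank of a matrix: the dimension of the left span of its rows. Over a division ring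
this is the usual rank. -/
noncomputable def rowRank {Q : Type*} [Ring Q] {m n : ℕ} (A : Matrix (Fin m) (Fin n) Q) : ℕ :=
  Module.finrank Q (Submodule.span Q (Set.range A.row))

/-- An automorphism `σ` of `D` is inner if it is conjugation by a unit. -/
def IsInnerAut {D : Type*} [Ring D] (σ : RingAut D) : Prop :=
  ∃ a : Dˣ, ∀ d : D, σ d = (↑a⁻¹ : D) * d * (a : D)

/-- `τ` has infinite inner order if no positive power of `τ` is inner. -/
def HasInfiniteInnerOrder {D : Type*} [Ring D] (τ : RingAut D) : Prop :=
  ∀ m : ℕ, 0 < m → ¬ IsInnerAut (τ ^ m)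

/-- The infinite cyclic group `⟨t⟩` acting on `D` by letting `t ^ i` act as `τ ^ i`. -/
abbrev laurentAction {D : Type*} [Ring D] (τ : RingAut D) :
    MulSemiringAction (Multiplicative ℤ) D :=
  MulSemiringAction.compHom D (zpowersHom (RingAut D) τ)

/-- The skew Laurent polynomial ring `D[t^{±1}; τ]`: finite sums `∑ dᵢ tⁱ`, `i ∈ ℤ`, with
coefficients on the left and multiplication determined by `t * d = τ(d) * t`. It is the skew
group ring of the infinite cyclic group `⟨t⟩` over `D`. -/
def SkewLaurent {D : Type*} [Ring D] (_τ : RingAut D) : Type _ :=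
  SkewMonoidAlgebra D (Multiplicative ℤ)

noncomputable instance SkewLaurent.instRing {D : Type*} [Ring D] (τ : RingAut D) :
    Ring (SkewLaurent τ) :=
  letI := laurentAction τ
  inferInstanceAs (Ring (SkewMonoidAlgebra D (Multiplicative ℤ)))

/-- The classical (left) quotient ring of `R`, the Ore localization of `R` at the set of all its
non-zero-divisors, which is defined once that set satisfies the left Ore condition. -/
abbrev OreQuotient (R : Type*) [Ring R] [OreLocalization.OreSet (nonZeroDivisors R)] : Type _ :=
  OreLocalization (nonZeroDivisors R) R

/-! The core claim is that every Sylvester rank function on `R` gives rank one to each nonzero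
element. The ring `R` is a domain with all left ideals principal (division with remainder by
`width`), hence left Ore, and it is simple because `τ` has infinite inner order. A nonzero `a` is a
unit, generates a maximal left ideal, or factors as `a = b * c` with `b` and `c` of smaller width;
Sylvester's inequality settles the last case by induction. If `R a` is maximal, simplicity makes
every power `(R / R a) ^ n` cyclic. Thus the identity matrix of size `n` is a left multiple of `a I`
plus a product of a column and a row, so `n ≤ n rk(a) + 1` for all `n`, which forces `rk(a) = 1`.

Once nonzero elements have rank one, clearing denominators shows that the rank of a matrix is its
rank over the division ring `Q`. The same argument with denominators `1` gives uniqueness over a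
division ring, in particular over `Q` and over the centre. The centre is a field since `R` is
simple. Existence only needs the usual rank on `Q`, which is then restricted. -/

namespace SylvesterRank

variable {R : Type*} [Ring R] (r : SylvesterRank R)

/-! ### Consequences of the axioms for matrices over finite index types -/

/-- Selecting rows and columns is multiplication by submatrices of identity matrices. Applied to a
reindexing and its inverse, this makes the rank independent of the enumeration of the indices. -/
theorem rk_submatrix_le {m n p q : ℕ} (A : Matrix (Fin m) (Fin n) R) (e : Fin p → Fin m)
    (f : Fin q → Fin n) : r.rk (A.submatrix e f) ≤ r.rk A := by
  have h : A.submatrix e f = (1 : Matrix (Fin m) (Fin m) R).submatrix e id * A *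
      (1 : Matrix (Fin n) (Fin n) R).submatrix id f := by
    rw [← Matrix.submatrix_id_id A, ← Matrix.submatrix_mul _ _ e id id Function.bijective_id,
      ← Matrix.submatrix_mul _ _ e id f Function.bijective_id]
    simp
  rw [h]
  exact ((r.rk_mul_le _ _).trans (min_le_left _ _)).trans
    ((r.rk_mul_le _ _).trans (min_le_right _ _))

/-- The rank of a matrix whose rows and columns are indexed by arbitrary finite types. -/
noncomputable def rank {m n : Type*} [Fintype m] [Fintype n] (A : Matrix m n R) : ℝ :=
  r.rk (A.submatrix (Fintype.equivFin m).symm (Fintype.equivFin n).symm)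

section Fintype

variable {l m n p q : Type*} [Fintype l] [Fintype m] [Fintype n] [Fintype p] [Fintype q]

theorem rank_eq_rk {a b : ℕ} (A : Matrix m n R) (e : Fin a ≃ m) (f : Fin b ≃ n) :
    r.rank A = r.rk (A.submatrix e f) := by
  apply le_antisymm
  · have : A.submatrix (Fintype.equivFin m).symm (Fintype.equivFin n).symm =
        (A.submatrix e f).submatrix (e.symm ∘ (Fintype.equivFin m).symm)
          (f.symm ∘ (Fintype.equivFin n).symm) := by
      ext; simp
    rw [rank, this]
    exact r.rk_submatrix_le _ _ _
  · have : A.submatrix e f = (A.submatrix (Fintype.equivFin m).symm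
        (Fintype.equivFin n).symm).submatrix (Fintype.equivFin m ∘ e)
          (Fintype.equivFin n ∘ f) := by
      ext; simp
    rw [rank, this]
    exact r.rk_submatrix_le _ _ _

theorem rank_fin {a b : ℕ} (A : Matrix (Fin a) (Fin b) R) : r.rank A = r.rk A :=
  r.rank_eq_rk A (Equiv.refl _) (Equiv.refl _)

theorem rank_submatrix_equiv (A : Matrix m n R) (e : p ≃ m) (f : q ≃ n) :
    r.rank (A.submatrix e f) = r.rank A :=
  (r.rank_eq_rk A ((Fintype.equivFin p).symm.trans e) ((Fintype.equivFin q).symm.trans f)).symm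

theorem rank_mul_le_left (A : Matrix l m R) (B : Matrix m n R) : r.rank (A * B) ≤ r.rank A := by
  unfold rank
  rw [← Matrix.submatrix_mul_equiv A B _ (Fintype.equivFin m).symm _]
  exact (r.rk_mul_le _ _).trans (min_le_left _ _)

theorem rank_mul_le_right (A : Matrix l m R) (B : Matrix m n R) :
    r.rank (A * B) ≤ r.rank B := by
  unfold rank
  rw [← Matrix.submatrix_mul_equiv A B _ (Fintype.equivFin m).symm _]
  exact (r.rk_mul_le _ _).trans (min_le_right _ _)

theorem rank_fromBlocks_eq_rk (A : Matrix m n R) (C : Matrix m q R) (B : Matrix p q R) :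
    r.rank (Matrix.fromBlocks A C 0 B) = r.rk (Matrix.reindex finSumFinEquiv finSumFinEquiv
      (Matrix.fromBlocks (A.submatrix (Fintype.equivFin m).symm (Fintype.equivFin n).symm)
        (C.submatrix (Fintype.equivFin m).symm (Fintype.equivFin q).symm) 0
        (B.submatrix (Fintype.equivFin p).symm (Fintype.equivFin q).symm))) := by
  rw [r.rank_eq_rk _
    (finSumFinEquiv.symm.trans ((Fintype.equivFin m).symm.sumCongr (Fintype.equivFin p).symm))
    (finSumFinEquiv.symm.trans ((Fintype.equivFin n).symm.sumCongr (Fintype.equivFin q).symm))]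
  congr 1
  ext i j
  obtain ⟨i, rfl⟩ := finSumFinEquiv.surjective i
  obtain ⟨j, rfl⟩ := finSumFinEquiv.surjective j
  cases i <;> cases j <;> simp

theorem rank_fromBlocks_diag (A : Matrix m n R) (B : Matrix p q R) :
    r.rank (Matrix.fromBlocks A 0 0 B) = r.rank A + r.rank B := by
  rw [rank_fromBlocks_eq_rk]
  exact r.rk_diag _ _

theorem rank_add_rank_le_fromBlocks (A : Matrix m n R) (C : Matrix m q R) (B : Matrix p q R) :
    r.rank A + r.rank B ≤ r.rank (Matrix.fromBlocks A C 0 B) := by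
  rw [rank_fromBlocks_eq_rk]
  exact r.rk_triangular _ _ _

theorem rank_fromRows_le (A : Matrix m n R) (B : Matrix p n R) :
    r.rank (Matrix.fromRows A B) ≤ r.rank A + r.rank B := by
  classical
  have h : Matrix.fromRows A B = Matrix.fromBlocks A 0 0 B *
      Matrix.fromRows (1 : Matrix n n R) (1 : Matrix n n R) := by
    rw [Matrix.fromBlocks_mul_fromRows]
    simp
  rw [h, ← rank_fromBlocks_diag]
  exact r.rank_mul_le_left _ _

theorem rank_add_le (A B : Matrix m n R) : r.rank (A + B) ≤ r.rank A + r.rank B := by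
  classical
  have h : A + B = Matrix.fromCols (1 : Matrix m m R) (1 : Matrix m m R) *
      Matrix.fromRows A B := by
    rw [Matrix.fromCols_mul_fromRows]
    simp
  rw [h]
  exact (r.rank_mul_le_right _ _).trans (r.rank_fromRows_le A B)

theorem rank_diagonal [DecidableEq m] (d : m → R) :
    r.rank (Matrix.diagonal d) = ∑ i, r.rank (Matrix.of fun _ _ : Unit => d i) := by
  revert d
  have key : ∀ (k : ℕ) (d : Fin k → R), r.rank (Matrix.diagonal d) =
      ∑ i, r.rank (Matrix.of fun _ _ : Unit => d i) := by
    intro k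
    induction k with
    | zero =>
      intro d
      rw [rank_fin, Subsingleton.elim (Matrix.diagonal d) 0, r.rk_zero]
      simp
    | succ k ih =>
      intro d
      rw [Fin.sum_univ_castSucc, ← ih, ← rank_fromBlocks_diag,
        ← r.rank_submatrix_equiv (Matrix.diagonal d)
          ((Equiv.sumCongr (Equiv.refl (Fin k)) (Equiv.ofUnique Unit (Fin 1))).trans
            finSumFinEquiv)
          ((Equiv.sumCongr (Equiv.refl (Fin k)) (Equiv.ofUnique Unit (Fin 1))).trans
            finSumFinEquiv)]
      congr 1
      ext i j
      rcases i with i | i <;> rcases j with j | j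
      · simp [Matrix.diagonal_apply]
        rfl
      · simp [Matrix.diagonal_apply, Fin.ext_iff]
        omega
      · simp [Matrix.diagonal_apply, Fin.ext_iff]
        omega
      · simp
        rfl
  intro d
  have h := r.rank_submatrix_equiv (Matrix.diagonal d) (Fintype.equivFin m).symm
    (Fintype.equivFin m).symm
  rw [Matrix.submatrix_diagonal_equiv, key] at h
  rw [← h, ← (Fintype.equivFin m).symm.sum_comp]
  rfl

theorem rank_of_one : r.rank (Matrix.of fun _ _ : Unit => (1 : R)) = 1 := by
  rw [r.rank_eq_rk _ (Equiv.ofUnique (Fin 1) Unit) (Equiv.ofUnique (Fin 1) Unit),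
    ← r.rk_one]
  congr 1
  ext i j
  obtain rfl := Subsingleton.elim i j
  simp

theorem rank_diagonal_of_forall [DecidableEq m] (d : m → R)
    (h : ∀ i, r.rank (Matrix.of fun _ _ : Unit => d i) = 1) :
    r.rank (Matrix.diagonal d) = Fintype.card m := by
  simp [rank_diagonal, h]

theorem rank_one [DecidableEq m] : r.rank (1 : Matrix m m R) = Fintype.card m := by
  rw [← Matrix.diagonal_one]
  exact r.rank_diagonal_of_forall _ fun _ => r.rank_of_one

theorem rank_le_card_rows (A : Matrix m n R) : r.rank A ≤ Fintype.card m := by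
  classical
  rw [← r.rank_one, ← Matrix.one_mul A]
  exact r.rank_mul_le_left _ _

theorem rank_le_card_cols (A : Matrix m n R) : r.rank A ≤ Fintype.card n := by
  classical
  rw [← r.rank_one, ← Matrix.mul_one A]
  exact r.rank_mul_le_right _ _

/-- Sylvester's rank inequality. -/
theorem rank_add_rank_le_card_add_rank_mul (A : Matrix l m R) (B : Matrix m n R) :
    r.rank A + r.rank B ≤ Fintype.card m + r.rank (A * B) := by
  classical
  -- Block row and column operations connect `diag(A * B, 1)` with a triangular matrix whose
  -- diagonal blocks are `B` and `A`.
  have h : Matrix.fromBlocks B 1 0 A =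
      (Matrix.fromBlocks 0 1 (-1) A : Matrix (m ⊕ l) (l ⊕ m) R) *
      (Matrix.fromBlocks (A * B) 0 0 1 : Matrix (l ⊕ m) (n ⊕ m) R) *
      (Matrix.fromBlocks 1 0 B 1 : Matrix (n ⊕ m) (n ⊕ m) R) := by
    simp [Matrix.fromBlocks_multiply]
  calc r.rank A + r.rank B = r.rank B + r.rank A := add_comm _ _
    _ ≤ r.rank (Matrix.fromBlocks B 1 0 A) := r.rank_add_rank_le_fromBlocks _ _ _
    _ ≤ r.rank (Matrix.fromBlocks (A * B) 0 0 (1 : Matrix m m R)) := by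
      rw [h]
      exact (r.rank_mul_le_left _ _).trans (r.rank_mul_le_right _ _)
    _ = _ := by rw [rank_fromBlocks_diag, rank_one, add_comm]

end Fintype

/-! ### Ranks of single elements -/

/-- The rank of a `1 × 1` matrix. -/
noncomputable def elementRank (a : R) : ℝ := r.rank (Matrix.of fun _ _ : Unit => a)

theorem elementRank_one : r.elementRank 1 = 1 := r.rank_of_one

theorem elementRank_le_one (a : R) : r.elementRank a ≤ 1 := by
  simpa [elementRank] using r.rank_le_card_rows (Matrix.of fun _ _ : Unit => a)

theorem of_mul_of (a b : R) : (Matrix.of fun _ _ : Unit => a) * (Matrix.of fun _ _ : Unit => b) =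
    Matrix.of fun _ _ : Unit => a * b := by
  ext; simp [Matrix.mul_apply]

theorem elementRank_mul_le_right (a b : R) : r.elementRank (a * b) ≤ r.elementRank b := by
  simp only [elementRank, ← of_mul_of]
  exact r.rank_mul_le_right _ _

theorem elementRank_eq_one_of_left_inverse {a b : R} (h : b * a = 1) : r.elementRank a = 1 := by
  refine le_antisymm (r.elementRank_le_one a) ?_
  rw [← r.elementRank_one, ← h]
  exact r.elementRank_mul_le_right _ _

theorem elementRank_mul_eq_one {a b : R} (ha : r.elementRank a = 1) (hb : r.elementRank b = 1) :
    r.elementRank (a * b) = 1 := by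
  refine le_antisymm (r.elementRank_le_one _) ?_
  have h := r.rank_add_rank_le_card_add_rank_mul (Matrix.of fun _ _ : Unit => a)
    (Matrix.of fun _ _ : Unit => b)
  rw [of_mul_of] at h
  simp only [elementRank] at *
  rw [ha, hb] at h
  simp at h
  linarith

/-- If for every `n` the module `(R / R a) ^ n` is cyclic, then `a` has rank one. -/
theorem elementRank_eq_one_of_forall_cyclic {a : R}
    (h : ∀ n : ℕ, ∃ (u v : Fin n → R) (X : Matrix (Fin n) (Fin n) R),
      ∀ i j, X i j * a + v i * u j = (1 : Matrix (Fin n) (Fin n) R) i j) :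
    r.elementRank a = 1 := by
  have key : ∀ n : ℕ, (n : ℝ) * (1 - r.elementRank a) ≤ 1 := by
    intro n
    obtain ⟨u, v, X, h⟩ := h n
    -- The hypothesis says `v i * u ≡ e_i` modulo `R a`, so `u` generates `(R / R a) ^ n`. The
    -- correction `v u` factors through one coordinate and has rank at most one.
    have hone : (1 : Matrix (Fin n) (Fin n) R) = X * Matrix.diagonal (fun _ => a) +
        (Matrix.of fun i (_ : Unit) => v i) * (Matrix.of fun (_ : Unit) j => u j) := by
      ext i j
      rw [Matrix.add_apply, Matrix.mul_diagonal, ← h]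
      simp [Matrix.mul_apply]
    have h1 := r.rank_one (m := Fin n)
    rw [hone] at h1
    have h2 := (r.rank_add_le (X * Matrix.diagonal (fun _ => a))
        ((Matrix.of fun i (_ : Unit) => v i) * (Matrix.of fun (_ : Unit) j => u j))).trans
      (add_le_add (r.rank_mul_le_right _ _) ((r.rank_mul_le_left _ _).trans
        (r.rank_le_card_cols _)))
    rw [h1, rank_diagonal] at h2
    simp only [Finset.sum_const, Finset.card_univ, Fintype.card_fin, nsmul_eq_mul,
      Fintype.card_unit, Nat.cast_one] at h2
    change (n : ℝ) ≤ n * r.elementRank a + 1 at h2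
    linarith
  refine le_antisymm (r.elementRank_le_one a) ?_
  by_contra! hlt
  obtain ⟨n, hn⟩ := exists_nat_gt (1 / (1 - r.elementRank a))
  rw [div_lt_iff₀ (by linarith)] at hn
  linarith [key n]

end SylvesterRank

/-! ### From elements to matrices by clearing denominators -/

/-- Finitely many elements of a ring of left fractions have a common left denominator. -/
theorem exists_common_denominator {R Q ι : Type*} [Ring R] [NoZeroDivisors R] [Nontrivial R]
    [Ring Q] (φ : R →+* Q) (hfrac : ∀ x : Q, ∃ s ≠ 0, ∃ a, φ s * x = φ a)
    [Finite ι] (x : ι → Q) : ∃ s ≠ 0, ∃ a : ι → R, ∀ i, φ s * x i = φ (a i) := by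
  have := Fintype.ofFinite ι
  classical
  have key : ∀ t : Finset ι, ∃ s ≠ 0, ∀ i ∈ t, ∃ a, φ s * x i = φ a := by
    intro t
    induction t using Finset.induction with
    | empty => exact ⟨1, one_ne_zero, by simp⟩
    | insert i t _ ih =>
      obtain ⟨s, hs, h⟩ := ih
      obtain ⟨s', hs', b, hb⟩ := hfrac (φ s * x i)
      refine ⟨s' * s, mul_ne_zero hs' hs, fun j hj => ?_⟩
      rcases Finset.mem_insert.1 hj with rfl | hj
      · exact ⟨b, by rw [map_mul, mul_assoc, hb]⟩
      · obtain ⟨a, ha⟩ := h j hj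
        exact ⟨s' * a, by rw [map_mul, mul_assoc, ha, map_mul]⟩
  obtain ⟨s, hs, h⟩ := key Finset.univ
  choose a ha using fun i => h i (Finset.mem_univ i)
  exact ⟨s, hs, a, ha⟩

theorem SylvesterRank.rank_eq_finrank_span_row {R Q m n : Type*} [Ring R] [NoZeroDivisors R]
    [Nontrivial R] [DivisionRing Q] [Fintype m] [Fintype n]
    (r : SylvesterRank R) (φ : R →+* Q) (hφ : Function.Injective φ)
    (hfrac : ∀ x : Q, ∃ s ≠ 0, ∃ a, φ s * x = φ a)
    (hr : ∀ a : R, a ≠ 0 → r.elementRank a = 1) (A : Matrix m n R) :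
    r.rank A = Module.finrank Q (Submodule.span Q (Set.range (A.map φ).row)) := by
  classical
  set W := Submodule.span Q (Set.range (A.map φ).row) with hW
  apply le_antisymm
  -- Upper bound: every row is a `Q`-combination of basis rows. A common denominator `s` turns this
  -- into a factorization of `s A` through `κ`, and Sylvester's inequality removes `s`, since `s I`
  -- has full rank.
  · obtain ⟨κ, a, ha, hspan, hli⟩ := exists_linearIndependent' Q (A.map φ).row
    have := Fintype.ofInjective a ha
    classical
    have hcard : Module.finrank Q W = Fintype.card κ := by
      rw [hW, ← hspan, finrank_span_eq_card hli]
    have hmem : ∀ i, ∃ c : κ → Q, ∑ k, c k • (A.map φ).row (a k) = (A.map φ).row i := by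
      intro i
      have : (A.map φ).row i ∈ Submodule.span Q (Set.range ((A.map φ).row ∘ a)) := by
        rw [hspan]
        exact Submodule.subset_span ⟨i, rfl⟩
      exact (Submodule.mem_span_range_iff_exists_fun Q).1 this
    choose c hc using hmem
    obtain ⟨s, hs, d, hd⟩ := exists_common_denominator φ hfrac fun p : m × κ => c p.1 p.2
    have hmul : Matrix.diagonal (fun _ : m => s) * A =
        Matrix.of (fun i k => d (i, k)) * A.submatrix a id := by
      ext i j
      apply hφ
      have hij := congrFun (hc i) j
      simp only [Finset.sum_apply, Pi.smul_apply, smul_eq_mul, Matrix.row, Matrix.map_apply] at hij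
      rw [Matrix.diagonal_mul, map_mul, ← hij, Matrix.mul_apply, map_sum, Finset.mul_sum]
      refine Finset.sum_congr rfl fun k _ => ?_
      simp [← mul_assoc, ← hd]
    have h1 := r.rank_add_rank_le_card_add_rank_mul (Matrix.diagonal (fun _ : m => s)) A
    have h2 : r.rank (Matrix.diagonal (fun _ : m => s) * A) ≤ Fintype.card κ := by
      rw [hmul]
      exact (r.rank_mul_le_left _ _).trans (r.rank_le_card_cols _)
    rw [r.rank_diagonal_of_forall _ fun _ => hr s hs] at h1
    rw [hcard]
    linarith
  -- Lower bound: standard vectors indexed by `κ`, forming a basis modulo the row space, complete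
  -- the rows of `A` to a spanning set. Then `s I` factors through `A` stacked on `E`, so `n ≤ rk A
  -- + |κ|`.
  · obtain ⟨κ, b, hb, hspan, hli⟩ :=
      exists_linearIndependent' Q fun j : n => W.mkQ (Pi.single j (1 : Q))
    have := Fintype.ofInjective b hb
    classical
    have htop : Submodule.span Q (Set.range fun j : n => W.mkQ (Pi.single j (1 : Q))) = ⊤ := by
      have h : (Set.range fun j : n => W.mkQ (Pi.single j (1 : Q))) =
          W.mkQ '' Set.range (Pi.basisFun Q n) := by
        rw [← Set.range_comp]
        congr 1
      rw [h, ← Submodule.map_span, (Pi.basisFun Q n).span_eq, Submodule.map_top,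
        Submodule.range_mkQ]
    have hcard : Module.finrank Q W + Fintype.card κ = Fintype.card n := by
      rw [← finrank_span_eq_card hli, hspan, htop, finrank_top, add_comm,
        Submodule.finrank_quotient_add_finrank, Module.finrank_fintype_fun_eq_card]
    set E : Matrix κ n R := (1 : Matrix n n R).submatrix b id with hE
    have hrows : Submodule.span Q (Set.range ((Matrix.fromRows A E).map φ).row) = ⊤ := by
      have hWle : W ≤ Submodule.span Q (Set.range ((Matrix.fromRows A E).map φ).row) := by
        refine Submodule.span_mono ?_
        rintro _ ⟨i, rfl⟩
        exact ⟨Sum.inl i, rfl⟩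
      rw [← sup_eq_right.2 hWle, ← Submodule.comap_map_mkQ,
        eq_top_iff, ← Submodule.map_le_iff_le_comap, Submodule.map_top, Submodule.range_mkQ,
        ← htop, ← hspan, Submodule.span_le]
      rintro _ ⟨k, rfl⟩
      refine ⟨_, Submodule.subset_span ⟨Sum.inr k, rfl⟩, ?_⟩
      simp only [Function.comp_apply]
      congr 1
      ext j
      simp [Matrix.row, hE, Matrix.one_apply, Pi.single_apply, eq_comm, apply_ite φ]
    have hmem : ∀ j : n, ∃ c : m ⊕ κ → Q,
        ∑ k, c k • ((Matrix.fromRows A E).map φ).row k = Pi.single j 1 := fun j =>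
      (Submodule.mem_span_range_iff_exists_fun Q).1 (by rw [hrows]; trivial)
    choose c hc using hmem
    obtain ⟨s, hs, d, hd⟩ := exists_common_denominator φ hfrac fun p : n × (m ⊕ κ) => c p.1 p.2
    have hmul : Matrix.diagonal (fun _ : n => s) =
        Matrix.of (fun i k => d (i, k)) * Matrix.fromRows A E := by
      ext i j
      apply hφ
      have hij := congrFun (hc i) j
      simp only [Finset.sum_apply, Pi.smul_apply, smul_eq_mul, Matrix.row, Matrix.map_apply] at hij
      have : φ (Matrix.diagonal (fun _ : n => s) i j) = φ s * (Pi.single i (1 : Q) : n → Q) j := by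
        by_cases h : i = j
        · subst h; simp
        · simp [Matrix.diagonal_apply_ne _ h, Pi.single_eq_of_ne (Ne.symm h)]
      rw [this, ← hij, Matrix.mul_apply, map_sum, Finset.mul_sum]
      refine Finset.sum_congr rfl fun k _ => ?_
      rw [map_mul, Matrix.of_apply, ← hd, mul_assoc]
    have h1 : (Fintype.card n : ℝ) ≤ r.rank A + Fintype.card κ := by
      rw [← r.rank_diagonal_of_forall (fun _ : n => s) fun _ => hr s hs, hmul]
      exact ((r.rank_mul_le_right _ _).trans (r.rank_fromRows_le _ _)).trans
        (add_le_add le_rfl (r.rank_le_card_rows _))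
    have h2 : (Module.finrank Q W : ℝ) + Fintype.card κ = Fintype.card n := by
      exact_mod_cast hcard
    linarith

/-! ### The usual rank over a division ring -/

section RowRank

variable {Q : Type*} [DivisionRing Q]

theorem rowRank_eq_finrank_range {m n : ℕ} (A : Matrix (Fin m) (Fin n) Q) :
    rowRank A = Module.finrank Q (LinearMap.range A.vecMulLinear) := by
  rw [rowRank, range_vecMulLinear]

theorem finrank_range_vecMulLinear_reindex {l m n p : Type*} [Fintype l] [Fintype m] [Fintype n]
    [Fintype p] (e : m ≃ l) (f : n ≃ p) (A : Matrix m n Q) :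
    Module.finrank Q (LinearMap.range (Matrix.reindex e f A).vecMulLinear) =
      Module.finrank Q (LinearMap.range A.vecMulLinear) := by
  have h : (Matrix.reindex e f A).vecMulLinear =
      (LinearEquiv.funCongrLeft Q Q f.symm).toLinearMap ∘ₗ A.vecMulLinear ∘ₗ
        (LinearEquiv.funCongrLeft Q Q e).toLinearMap := by
    refine LinearMap.ext fun x => funext fun i => ?_
    simp only [Matrix.vecMulLinear_apply, Matrix.vecMul, dotProduct, LinearMap.comp_apply,
      LinearEquiv.coe_coe, LinearEquiv.funCongrLeft_apply, LinearMap.funLeft_apply,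
      Matrix.reindex_apply, Matrix.submatrix_apply]
    exact Fintype.sum_equiv e.symm _ _ (by simp)
  rw [h, LinearMap.range_comp, LinearMap.range_comp, LinearEquiv.range, Submodule.map_top,
    LinearEquiv.finrank_map_eq]

theorem rowRank_mul_le {l m n : ℕ} (A : Matrix (Fin l) (Fin m) Q) (B : Matrix (Fin m) (Fin n) Q) :
    rowRank (A * B) ≤ min (rowRank A) (rowRank B) := by
  have h : (A * B).vecMulLinear = B.vecMulLinear ∘ₗ A.vecMulLinear := by
    refine LinearMap.ext fun x => ?_
    simp
  rw [rowRank_eq_finrank_range, rowRank_eq_finrank_range, rowRank_eq_finrank_range, h,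
    LinearMap.range_comp]
  exact le_min (Submodule.finrank_map_le _ _)
    (Submodule.finrank_mono (LinearMap.map_le_range))

variable {m n p q : ℕ} (A : Matrix (Fin m) (Fin n) Q) (B : Matrix (Fin p) (Fin q) Q)
  (C : Matrix (Fin m) (Fin q) Q)

/-- Project the row space of the block matrix to the first `n` coordinates. The image contains the
row space of `A`, and the kernel contains a copy of the row space of `B`; rank-nullity concludes. -/
theorem rowRank_add_rowRank_le : rowRank A + rowRank B ≤
    rowRank (Matrix.reindex finSumFinEquiv finSumFinEquiv (Matrix.fromBlocks A C 0 B)) := by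
  simp only [rowRank_eq_finrank_range, finrank_range_vecMulLinear_reindex]
  set M := LinearMap.range (Matrix.fromBlocks A C 0 B).vecMulLinear
  set π : M →ₗ[Q] (Fin n → Q) := (LinearMap.funLeft Q Q Sum.inl).domRestrict M
  rw [← LinearMap.finrank_range_add_finrank_ker π]
  refine add_le_add (Submodule.finrank_mono ?_) ?_
  · rintro _ ⟨x, rfl⟩
    refine ⟨⟨_, Sum.elim x 0, rfl⟩, ?_⟩
    ext i
    simp [π, LinearMap.funLeft, Matrix.vecMul_fromBlocks]
  · let g : LinearMap.range B.vecMulLinear →ₗ[Q] LinearMap.ker π :=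
      LinearMap.codRestrict _ (LinearMap.codRestrict M
        ((LinearEquiv.sumArrowLequivProdArrow (Fin n) (Fin q) Q Q).symm.toLinearMap ∘ₗ
          LinearMap.inr Q _ _ ∘ₗ Submodule.subtype _) (by
          rintro ⟨_, x, rfl⟩
          refine ⟨Sum.elim 0 x, ?_⟩
          ext i
          rcases i with i | i <;> simp [Matrix.vecMul_fromBlocks])) (by
        rintro ⟨_, x, rfl⟩
        ext i
        simp [π, LinearMap.funLeft])
    refine LinearMap.finrank_le_finrank_of_injective (f := g) ?_
    intro x y hxy
    ext i
    have := congrArg (fun z => z.1.1 (Sum.inr i)) hxy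
    simpa [g] using this

theorem rowRank_diag_le :
    rowRank (Matrix.reindex finSumFinEquiv finSumFinEquiv (Matrix.fromBlocks A 0 0 B)) ≤
      rowRank A + rowRank B := by
  simp only [rowRank_eq_finrank_range, finrank_range_vecMulLinear_reindex]
  rw [← Module.finrank_prod]
  let g : LinearMap.range (Matrix.fromBlocks A 0 0 B).vecMulLinear →ₗ[Q]
      LinearMap.range A.vecMulLinear × LinearMap.range B.vecMulLinear :=
    LinearMap.prod
      (LinearMap.codRestrict _ (LinearMap.funLeft Q Q Sum.inl ∘ₗ Submodule.subtype _) (by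
        rintro ⟨_, x, rfl⟩
        refine ⟨x ∘ Sum.inl, ?_⟩
        ext i
        simp [LinearMap.funLeft, Matrix.vecMul_fromBlocks]))
      (LinearMap.codRestrict _ (LinearMap.funLeft Q Q Sum.inr ∘ₗ Submodule.subtype _) (by
        rintro ⟨_, x, rfl⟩
        refine ⟨x ∘ Sum.inr, ?_⟩
        ext i
        simp [LinearMap.funLeft, Matrix.vecMul_fromBlocks]))
  refine LinearMap.finrank_le_finrank_of_injective (f := g) ?_
  intro x y hxy
  ext i
  rcases i with i | i
  · have := congrArg (fun z => z.1.1 i) hxy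
    simpa [g, LinearMap.funLeft] using this
  · have := congrArg (fun z => z.2.1 i) hxy
    simpa [g, LinearMap.funLeft] using this

/-- The usual rank of matrices over a division ring. -/
noncomputable def SylvesterRank.ofDivisionRing (Q : Type*) [DivisionRing Q] :
    SylvesterRank Q where
  rk A := rowRank A
  rk_nonneg _ := Nat.cast_nonneg _
  rk_zero m n := by
    have : Set.range (0 : Matrix (Fin m) (Fin n) Q).row ⊆ {0} := by
      rintro _ ⟨i, rfl⟩
      rfl
    rw [rowRank, Submodule.span_eq_bot.2 this, finrank_bot, Nat.cast_zero]
  rk_one := by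
    rw [rowRank_eq_finrank_range, LinearMap.range_eq_top.2, finrank_top,
      Module.finrank_fintype_fun_eq_card]
    · simp
    · intro x
      exact ⟨x, by simp⟩
  rk_mul_le A B := by exact_mod_cast rowRank_mul_le A B
  rk_diag A B := by
    exact_mod_cast le_antisymm (rowRank_diag_le A B) (rowRank_add_rowRank_le A B 0)
  rk_triangular A B C := by exact_mod_cast rowRank_add_rowRank_le A B C

end RowRank

theorem SylvesterRank.rk_eq_rowRank_map {R Q : Type*} [Ring R] [NoZeroDivisors R]
    [Nontrivial R] [DivisionRing Q] (r : SylvesterRank R) (φ : R →+* Q)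
    (hφ : Function.Injective φ) (hfrac : ∀ x : Q, ∃ s ≠ 0, ∃ a, φ s * x = φ a)
    (hr : ∀ a : R, a ≠ 0 → r.elementRank a = 1) {m n : ℕ} (A : Matrix (Fin m) (Fin n) R) :
    r.rk A = rowRank (A.map φ) := by
  rw [← rank_fin, r.rank_eq_finrank_span_row φ hφ hfrac hr, rowRank]

/-- A Sylvester rank function on a division ring is the usual rank. -/
theorem SylvesterRank.rk_eq_rowRank {Q : Type*} [DivisionRing Q] (r : SylvesterRank Q) {m n : ℕ}
    (A : Matrix (Fin m) (Fin n) Q) : r.rk A = rowRank A :=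
  r.rk_eq_rowRank_map (RingHom.id Q) Function.injective_id (fun x => ⟨1, one_ne_zero, x, by simp⟩)
    (fun _ ha => r.elementRank_eq_one_of_left_inverse (inv_mul_cancel₀ ha)) A

theorem SylvesterRank.rk_eq_rank_of_isField {F : Type*} [CommRing F] (hF : IsField F)
    (r : SylvesterRank F) {m n : ℕ} (A : Matrix (Fin m) (Fin n) F) : r.rk A = A.rank := by
  let _ := hF.toField
  rw [Matrix.rank_eq_finrank_span_row]
  exact r.rk_eq_rowRank A

/-! ### Left principal ideal domains and simple Ore domains -/

section LeftPrincipalIdeal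

variable {R : Type*} [Ring R] [NoZeroDivisors R]

/-- A domain whose left ideals are principal is left Ore. -/
theorem exists_mul_eq_mul_of_isPrincipalIdealRing [Nontrivial R] [IsPrincipalIdealRing R]
    (a : R) {b : R} (hb : b ≠ 0) : ∃ s ≠ 0, ∃ c, s * a = c * b := by
  by_cases ha : a = 0
  · exact ⟨1, one_ne_zero, 0, by simp [ha]⟩
  obtain ⟨c, hc⟩ := IsPrincipalIdealRing.principal (Ideal.span {a, b})
  have hac : a ∈ Ideal.span {a, b} := Ideal.subset_span (by simp)
  have hbc : b ∈ Ideal.span {a, b} := Ideal.subset_span (by simp)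
  have hcc : c ∈ Ideal.span {a, b} := by
    rw [hc]
    exact Submodule.mem_span_singleton_self c
  rw [hc, Submodule.mem_span_singleton] at hac hbc
  obtain ⟨a', ha'⟩ := hac
  obtain ⟨b', hb'⟩ := hbc
  obtain ⟨x, y, hxy⟩ := Submodule.mem_span_pair.1 hcc
  simp only [smul_eq_mul] at ha' hb' hxy
  -- Here `R a + R b = R c`, and substituting `c = x a + y b` into `a = a' c` gives a common left
  -- multiple. It is degenerate only if `1 = a' x`; then `y = 0`, so `b` itself is a left multiple
  -- of `a`.
  have hax : (1 - a' * x) * a = a' * y * b := by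
    rw [sub_mul, one_mul, sub_eq_iff_eq_add', mul_assoc, mul_assoc, ← mul_add, hxy, ha']
  by_cases h : 1 - a' * x = 0
  · have hy : y = 0 := by
      have h1 : a' * y * b = 0 := by rw [← hax, h, zero_mul]
      have ha0 : a' ≠ 0 := by
        rintro rfl
        exact ha (by rw [← ha', zero_mul])
      simpa [ha0, hb] using h1
    refine ⟨b' * x, ?_, 1, ?_⟩
    · intro h0
      apply hb
      rw [← hb', ← hxy, hy, zero_mul, add_zero, ← mul_assoc, h0, zero_mul]
    · rw [one_mul, ← hb', ← hxy, hy, zero_mul, add_zero, mul_assoc]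
  · exact ⟨_, h, _, hax⟩

theorem nonempty_oreSet_nonZeroDivisors [Nontrivial R] [IsPrincipalIdealRing R] :
    Nonempty (OreLocalization.OreSet (nonZeroDivisors R)) := by
  rw [OreLocalization.nonempty_oreSet_iff_of_noZeroDivisors]
  intro a s
  obtain ⟨s', hs', c, h⟩ :=
    exists_mul_eq_mul_of_isPrincipalIdealRing a (nonZeroDivisors.ne_zero s.2)
  exact ⟨c, ⟨s', mem_nonZeroDivisors_of_ne_zero hs'⟩, h⟩

/-- In a simple ring no nonzero right ideal is contained in a proper left ideal. -/
theorem exists_mul_notMem_of_isSimpleRing {S : Type*} [Ring S] [IsSimpleRing S] {I : Ideal S}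
    (hI : I ≠ ⊤) {b : S} (hb : b ≠ 0) : ∃ s, b * s ∉ I := by
  by_contra! h
  -- This is the annihilator of the left module `S / I`; under the negated claim it contains `b`,
  -- and it is proper.
  let J : TwoSidedIdeal S := TwoSidedIdeal.mk' {x | ∀ s, x * s ∈ I}
    (fun s => by simp)
    (fun hx hy s => by rw [add_mul]; exact I.add_mem (hx s) (hy s))
    (fun hx s => by rw [neg_mul]; exact I.neg_mem (hx s))
    (fun {x y} hy s => by rw [mul_assoc]; exact I.mul_mem_left x (hy s))
    (fun {x y} hx s => by rw [mul_assoc]; exact hx (y * s))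
  have hJ : ∀ x, x ∈ J ↔ ∀ s, x * s ∈ I := fun x => TwoSidedIdeal.mem_mk' _ _ _ _ _ _ x
  rcases IsSimpleRing.simple.eq_bot_or_eq_top J with h0 | h1
  · have hbJ : b ∈ J := (hJ b).2 h
    rw [h0] at hbJ
    exact hb (by simpa using hbJ)
  · apply hI
    rw [Ideal.eq_top_iff_one]
    have : (1 : S) ∈ J := by rw [h1]; trivial
    simpa using (hJ 1).1 this 1

/-- Over a simple left Ore domain, the finite powers of the simple module `R / R a`, `a ≠ 0`,
are cyclic. -/
theorem exists_cyclic_generator_of_isMaximal [IsSimpleRing R]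
    (hore : ∀ a b : R, b ≠ 0 → ∃ s ≠ 0, ∃ c, s * a = c * b) {a : R} (ha : a ≠ 0)
    (hmax : (Ideal.span {a}).IsMaximal) (n : ℕ) :
    ∃ (u v : Fin n → R) (X : Matrix (Fin n) (Fin n) R),
      ∀ i j, X i j * a + v i * u j = (1 : Matrix (Fin n) (Fin n) R) i j := by
  -- The induction also carries a nonzero `b` annihilating the generator `u` modulo `R a`; such a
  -- `b` isolates a newly added coordinate.
  suffices h : ∃ (u v : Fin n → R) (X : Matrix (Fin n) (Fin n) R) (b : R) (w : Fin n → R),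
      b ≠ 0 ∧ (∀ i, b * u i = w i * a) ∧
      ∀ i j, X i j * a + v i * u j = (1 : Matrix (Fin n) (Fin n) R) i j by
    obtain ⟨u, v, X, -, -, -, -, h⟩ := h
    exact ⟨u, v, X, h⟩
  induction n with
  | zero =>
    exact ⟨0, 0, 0, 1, 0, one_ne_zero, fun i => i.elim0, fun i => i.elim0⟩
  | succ n ih =>
    obtain ⟨u, v, X, b, w, hb, hw, hX⟩ := ih
    obtain ⟨s, hs⟩ := exists_mul_notMem_of_isSimpleRing hmax.ne_top hb
    obtain ⟨p, y, hy, hpq⟩ := hmax.exists_inv hs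
    obtain ⟨q, rfl⟩ := Submodule.mem_span_singleton.1 hy
    rw [smul_eq_mul] at hpq
    obtain ⟨b', hb', c, hc⟩ := hore (b * s) a ha
    -- Modulo `R a`, `b` sends `(u, s)` to `(0, b s)`, and `p b s ≡ 1`, so `p b` produces the last
    -- basis vector. Subtracting `v i * s` times it from `v i * (u, s)` leaves `e_i`. The matrix
    -- records the exact multiples of `a`, and `b' * b` annihilates the new generator.
    refine ⟨Fin.snoc u s, Fin.snoc (fun i => v i - v i * s * p * b) (p * b),
      Matrix.of (Fin.snoc (fun i => Fin.snoc (fun j => X i j + v i * s * p * w j)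
          (-(v i * s * q)) : Fin n → Fin (n + 1) → R)
        (Fin.snoc (fun j => -(p * w j)) q : Fin (n + 1) → R)),
      b' * b, Fin.snoc (fun i => b' * w i) c, mul_ne_zero hb' hb, ?_, ?_⟩
    · intro i
      refine Fin.lastCases ?_ (fun i => ?_) i
      · simp [mul_assoc, hc]
      · simp [mul_assoc, hw]
    · intro i j
      refine Fin.lastCases ?_ (fun i => ?_) i <;> refine Fin.lastCases ?_ (fun j => ?_) j
      · simp only [Matrix.of_apply, Fin.snoc_last, Matrix.one_apply_eq]
        rw [← hpq]
        noncomm_ring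
      · simp only [Matrix.of_apply, Fin.snoc_last, Fin.snoc_castSucc]
        rw [Matrix.one_apply_ne (Fin.castSucc_lt_last j).ne', mul_assoc p b, hw]
        noncomm_ring
      · simp only [Matrix.of_apply, Fin.snoc_last, Fin.snoc_castSucc]
        rw [Matrix.one_apply_ne (Fin.castSucc_lt_last i).ne]
        calc _ = v i * s * (1 - (p * (b * s) + q * a)) := by noncomm_ring
          _ = 0 := by rw [hpq]; simp
      · simp only [Matrix.of_apply, Fin.snoc_castSucc]
        have h1 : (1 : Matrix (Fin (n + 1)) (Fin (n + 1)) R) i.castSucc j.castSucc =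
            (1 : Matrix (Fin n) (Fin n) R) i j := by
          simp [Matrix.one_apply]
        rw [h1, ← hX i j]
        calc _ = X i j * a + v i * u j + v i * s * p * (w j * a - b * u j) := by noncomm_ring
          _ = _ := by rw [hw]; simp

end LeftPrincipalIdeal

/-! ### Coefficients in the skew Laurent ring -/

namespace SkewLaurent

variable {D : Type*} [DivisionRing D] {τ : RingAut D}

/-- The coefficient of `t ^ n`. -/
def coeff (f : SkewLaurent τ) (n : ℤ) : D := SkewMonoidAlgebra.coeff f (Multiplicative.ofAdd n)

/-- The monomial `d t ^ n`. -/
noncomputable def monomial (n : ℤ) (d : D) : SkewLaurent τ :=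
  SkewMonoidAlgebra.single (Multiplicative.ofAdd n) d

theorem ext_coeff {f g : SkewLaurent τ} (h : ∀ n, f.coeff n = g.coeff n) : f = g :=
  SkewMonoidAlgebra.ext h

theorem coeff_zero (n : ℤ) : (0 : SkewLaurent τ).coeff n = 0 := rfl

theorem coeff_one (n : ℤ) : (1 : SkewLaurent τ).coeff n = if n = 0 then 1 else 0 := by
  let _ := laurentAction τ
  change (SkewMonoidAlgebra.coeff (1 : SkewMonoidAlgebra D (Multiplicative ℤ))
    (Multiplicative.ofAdd n)) = _
  rw [SkewMonoidAlgebra.coeff_one, Finsupp.single_apply]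
  exact if_congr eq_comm rfl rfl

theorem coeff_sub (f g : SkewLaurent τ) (n : ℤ) : (f - g).coeff n = f.coeff n - g.coeff n := by
  rw [eq_sub_iff_add_eq]
  have h : ((f - g) + g).coeff n = (f - g).coeff n + g.coeff n := by
    exact congrArg (fun x => x (Multiplicative.ofAdd n))
      (SkewMonoidAlgebra.coeff_add (k := D) (G := Multiplicative ℤ) (f - g) g)
  rw [← h, sub_add_cancel]

theorem coeff_monomial_mul (k : ℤ) (c : D) (f : SkewLaurent τ) (n : ℤ) :
    (monomial k c * f).coeff n = c * (τ ^ k) (f.coeff (n - k)) := by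
  let _ := laurentAction τ
  refine (SkewMonoidAlgebra.coeff_single_mul c (Multiplicative.ofAdd k) f _).trans ?_
  rw [← ofAdd_neg, ← ofAdd_add, neg_add_eq_sub]
  rfl

theorem coeff_mul_monomial (k : ℤ) (c : D) (f : SkewLaurent τ) (n : ℤ) :
    (f * monomial k c).coeff n = f.coeff (n - k) * (τ ^ (n - k)) c := by
  let _ := laurentAction τ
  refine (SkewMonoidAlgebra.coeff_mul_single f c (Multiplicative.ofAdd k) _).trans ?_
  rw [← ofAdd_neg, ← ofAdd_add, ← sub_eq_add_neg]
  rfl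

theorem finite_coeff_ne_zero (f : SkewLaurent τ) : {n | f.coeff n ≠ 0}.Finite := by
  refine ((SkewMonoidAlgebra.support f).finite_toSet.preimage
    (f := Multiplicative.ofAdd) Multiplicative.ofAdd.injective.injOn).subset ?_
  intro n hn
  exact SkewMonoidAlgebra.mem_support_iff.2 hn

/-- If only one pair of coefficients contributes to a coefficient of a product, then it is the
product of that pair. -/
theorem coeff_mul_of_unique (f g : SkewLaurent τ) (n p : ℤ)
    (h : ∀ i, i ≠ p → f.coeff i = 0 ∨ g.coeff (n - i) = 0) :
    (f * g).coeff n = f.coeff p * (τ ^ p) (g.coeff (n - p)) := by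
  let _ := laurentAction τ
  refine (SkewMonoidAlgebra.coeff_mul_left f g _).trans ?_
  refine (SkewMonoidAlgebra.sum_def _ _).trans ?_
  have hterm : ∀ (i : ℤ), (Multiplicative.ofAdd i) •
      SkewMonoidAlgebra.coeff g ((Multiplicative.ofAdd i)⁻¹ * Multiplicative.ofAdd n) =
      (τ ^ i) (g.coeff (n - i)) := by
    intro i
    rw [← ofAdd_neg, ← ofAdd_add, neg_add_eq_sub]
    rfl
  rw [Finsupp.sum, Finset.sum_eq_single (Multiplicative.ofAdd p)]
  · rw [hterm]
    rfl
  · intro b _ hb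
    obtain ⟨i, rfl⟩ := Multiplicative.ofAdd.surjective b
    rw [hterm]
    rcases h i (by rintro rfl; exact hb rfl) with h | h
    · exact mul_eq_zero_of_left h _
    · rw [h, map_zero, mul_zero]
  · intro hp
    rw [Finsupp.notMem_support_iff] at hp
    rw [hp, zero_mul]

/-! ### Width, absence of zero divisors, division with remainder -/

/-- The length of the smallest interval that contains the exponents of `f`. -/
noncomputable def width (f : SkewLaurent τ) : ℕ :=
  sInf {N : ℕ | ∃ r : ℤ, ∀ i, f.coeff i ≠ 0 → r ≤ i ∧ i < r + N}

theorem width_le {f : SkewLaurent τ} {N : ℕ} (r : ℤ)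
    (h : ∀ i, f.coeff i ≠ 0 → r ≤ i ∧ i < r + N) : f.width ≤ N :=
  Nat.sInf_le ⟨r, h⟩

theorem exists_extremal {f : SkewLaurent τ} (hf : f ≠ 0) : ∃ (p : ℤ) (k : ℕ), f.width = k + 1 ∧
    f.coeff p ≠ 0 ∧ f.coeff (p + k) ≠ 0 ∧ ∀ i, f.coeff i ≠ 0 → p ≤ i ∧ i ≤ p + k := by
  have hne : {n | f.coeff n ≠ 0}.Nonempty := by
    by_contra h
    rw [Set.not_nonempty_iff_eq_empty] at h
    refine hf (ext_coeff fun n => ?_)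
    by_contra hn
    exact (h ▸ (show n ∈ {n | f.coeff n ≠ 0} from hn) : n ∈ (∅ : Set ℤ))
  obtain ⟨p, hp, hpmin⟩ := Set.exists_min_image _ id f.finite_coeff_ne_zero hne
  obtain ⟨q, hq, hqmax⟩ := Set.exists_max_image _ id f.finite_coeff_ne_zero hne
  simp only [id, Set.mem_ofPred_eq] at hp hpmin hq hqmax
  obtain ⟨k, hk⟩ := Int.le.dest (hpmin q hq)
  subst hk
  have hw : f.width ≤ k + 1 := width_le p fun i hi => by
    have := hpmin i hi
    have := hqmax i hi
    push_cast
    omega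
  refine ⟨p, k, le_antisymm hw ?_, hp, hq, fun i hi => ⟨hpmin i hi, hqmax i hi⟩⟩
  obtain ⟨r, hr⟩ := Nat.sInf_mem (s := {N : ℕ | ∃ r : ℤ, ∀ i, f.coeff i ≠ 0 → r ≤ i ∧ i < r + N})
    ⟨k + 1, p, fun i hi => by
      have := hpmin i hi
      have := hqmax i hi
      push_cast
      omega⟩
  have h1 := hr p hp
  have h2 := hr _ hq
  change _ ≤ sInf _
  omega

/-- Only one pair of exponents can reach the lowest or the highest possible exponent of a product.
Both the absence of zero divisors and the width inequality rest on this. -/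
theorem coeff_mul_extremal {f g : SkewLaurent τ} {p q : ℤ} {k l : ℕ}
    (hf : ∀ i, f.coeff i ≠ 0 → p ≤ i ∧ i ≤ p + k) (hg : ∀ i, g.coeff i ≠ 0 → q ≤ i ∧ i ≤ q + l) :
    (f * g).coeff (p + q) = f.coeff p * (τ ^ p) (g.coeff q) ∧
    (f * g).coeff (p + k + (q + l)) = f.coeff (p + k) * (τ ^ (p + k)) (g.coeff (q + l)) := by
  constructor
  · rw [coeff_mul_of_unique f g (p + q) p, add_sub_cancel_left]
    intro i hi
    by_contra! h
    have := hf i h.1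
    have := hg _ h.2
    omega
  · rw [coeff_mul_of_unique f g (p + k + (q + l)) (p + k), add_sub_cancel_left]
    intro i hi
    by_contra! h
    have := hf i h.1
    have := hg _ h.2
    omega

theorem ne_zero_of_coeff_ne_zero {f : SkewLaurent τ} {n : ℤ} (h : f.coeff n ≠ 0) : f ≠ 0 := by
  rintro rfl
  exact h rfl

instance : NoZeroDivisors (SkewLaurent τ) where
  eq_zero_or_eq_zero_of_mul_eq_zero {f g} h := by
    by_contra! hfg
    obtain ⟨p, k, -, hp, -, hf⟩ := exists_extremal hfg.1
    obtain ⟨q, l, -, hq, -, hg⟩ := exists_extremal hfg.2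
    refine ne_zero_of_coeff_ne_zero (n := p + q) ?_ h
    rw [(coeff_mul_extremal hf hg).1]
    exact mul_ne_zero hp (by simpa using hq)

instance : Nontrivial (SkewLaurent τ) :=
  ⟨⟨1, 0, ne_zero_of_coeff_ne_zero (n := 0) (by simp [coeff_one])⟩⟩

theorem width_add_width_le {f g : SkewLaurent τ} (hf : f ≠ 0) (hg : g ≠ 0) :
    f.width + g.width ≤ (f * g).width + 1 := by
  obtain ⟨p, k, hfw, hp, hp', hf⟩ := exists_extremal hf
  obtain ⟨q, l, hgw, hq, hq', hg⟩ := exists_extremal hg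
  obtain ⟨h1, h2⟩ := coeff_mul_extremal hf hg
  have h1' : (f * g).coeff (p + q) ≠ 0 := by
    rw [h1]
    exact mul_ne_zero hp (by simpa using hq)
  have h2' : (f * g).coeff (p + k + (q + l)) ≠ 0 := by
    rw [h2]
    exact mul_ne_zero hp' (by simpa using hq')
  obtain ⟨s, j, hw, -, -, hs⟩ := exists_extremal (ne_zero_of_coeff_ne_zero h1')
  have := hs _ h1'
  have := hs _ h2'
  omega

/-- The factor moves exponent `p` to `0` and, if the coefficient there is nonzero, makes it `1`. The
twist by `τ ^ (-p)` compensates for `t ^ (-p)` passing the coefficients. -/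
theorem coeff_normalize (f : SkewLaurent τ) (p n : ℤ) :
    (monomial (-p) ((τ ^ (-p)) (f.coeff p)⁻¹) * f).coeff n =
      (τ ^ (-p)) ((f.coeff p)⁻¹ * f.coeff (n + p)) := by
  rw [coeff_monomial_mul, sub_neg_eq_add, map_mul]

theorem exists_left_inverse_of_width_eq_one {f : SkewLaurent τ} (hf : f ≠ 0)
    (h : f.width = 1) : ∃ g, g * f = 1 := by
  obtain ⟨p, k, hfw, hp, hp', hi⟩ := exists_extremal hf
  obtain rfl : k = 0 := by omega
  refine ⟨monomial (-p) ((τ ^ (-p)) (f.coeff p)⁻¹), ext_coeff fun n => ?_⟩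
  rw [coeff_normalize, coeff_one]
  split_ifs with hn
  · rw [hn, zero_add, inv_mul_cancel₀ hp, map_one]
  · have : f.coeff (n + p) = 0 := by
      by_contra h0
      have := hi _ h0
      push_cast at this
      omega
    rw [this, mul_zero, map_zero]

/-- Left division with remainder. -/
theorem exists_width_sub_mul_lt (f : SkewLaurent τ) {a : SkewLaurent τ} (ha : a ≠ 0) :
    ∃ q, (f - q * a).width < a.width := by
  obtain ⟨p, k, hw, -, hpk, ha⟩ := exists_extremal ha
  -- Induction on the length of an interval containing the exponents of `f`: while it exceeds `k`,
  -- cancel the top coefficient by a left monomial multiple of `a`, which stays inside the interval.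
  have key : ∀ (N : ℕ) (r : ℤ) (f : SkewLaurent τ),
      (∀ i, f.coeff i ≠ 0 → r ≤ i ∧ i < r + N) → ∃ q, (f - q * a).width ≤ k := by
    intro N
    induction N with
    | zero =>
      intro r f hf
      refine ⟨0, width_le r fun i hi => ?_⟩
      rw [zero_mul, sub_zero] at hi
      have := hf i hi
      push_cast at this
      omega
    | succ N ih =>
      intro r f hf
      by_cases hN : N < k
      · refine ⟨0, width_le r fun i hi => ?_⟩
        rw [zero_mul, sub_zero] at hi
        have := hf i hi
        push_cast at this
        omega
      · set e : ℤ := r + N - (p + k) with he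
        set c : D := f.coeff (r + N) * ((τ ^ e) (a.coeff (p + k)))⁻¹ with hc
        obtain ⟨q, hq⟩ := ih r (f - monomial e c * a) (by
          intro i hi
          rw [coeff_sub, coeff_monomial_mul] at hi
          by_cases hir : i = r + N
          · exfalso
            apply hi
            have h1 : i - e = p + k := by omega
            have h2 : (τ ^ e) (a.coeff (p + k)) ≠ 0 := by simpa using hpk
            rw [h1, hc, inv_mul_cancel_right₀ h2, hir, sub_self]
          · by_cases hfi : f.coeff i = 0
            · have h1 : a.coeff (i - e) ≠ 0 := by
                intro h0
                rw [hfi, h0, map_zero, mul_zero, sub_zero] at hi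
                exact hi rfl
              have := ha _ h1
              omega
            · have := hf i hfi
              push_cast at this
              omega)
        exact ⟨monomial e c + q, by rwa [add_mul, ← sub_sub]⟩
  by_cases hf : f = 0
  · obtain ⟨q, hq⟩ := key 0 0 f (by intro i hi; rw [hf] at hi; exact absurd rfl hi)
    exact ⟨q, by omega⟩
  · obtain ⟨s, j, -, -, -, hs⟩ := exists_extremal hf
    obtain ⟨q, hq⟩ := key (j + 1) s f fun i hi => by
      have := hs i hi
      push_cast
      omega
    exact ⟨q, by omega⟩

/-- Euclid's argument: a nonzero element of least width generates a nonzero left ideal. -/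
instance : IsPrincipalIdealRing (SkewLaurent τ) where
  principal I := by
    by_cases hI : I = ⊥
    · exact ⟨0, by rw [hI, Submodule.span_zero_singleton]⟩
    obtain ⟨b, hb, hb0⟩ := Submodule.exists_mem_ne_zero_of_ne_bot hI
    obtain ⟨a, ⟨haI, ha0⟩, hmin⟩ := (measure (width (τ := τ))).wf.has_min
      {a | a ∈ I ∧ a ≠ 0} ⟨b, hb, hb0⟩
    refine ⟨a, le_antisymm (fun f hf => ?_) ((Submodule.span_singleton_le_iff_mem _ _).2 haI)⟩
    obtain ⟨q, hq⟩ := exists_width_sub_mul_lt f ha0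
    rw [Submodule.mem_span_singleton]
    refine ⟨q, ?_⟩
    by_contra hne
    exact hmin (f - q * a) ⟨I.sub_mem hf (I.mul_mem_left q haI),
      fun h => hne (sub_eq_zero.1 h).symm⟩ hq

/-! ### Simplicity, and the rank of nonzero elements -/

theorem eq_zero_of_conj (hτ : HasInfiniteInnerOrder τ) {n : ℤ} (hn : n ≠ 0) {y : D}
    (h : ∀ d, d * y = y * (τ ^ n) d) : y = 0 := by
  by_contra hy
  obtain ⟨m, rfl | rfl⟩ := n.eq_nat_or_neg
  · refine hτ m (by omega) ⟨Units.mk0 y hy, fun d => ?_⟩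
    rw [← zpow_natCast, Units.val_inv_eq_inv_val, Units.val_mk0, mul_assoc, h,
      inv_mul_cancel_left₀ hy]
  · refine hτ m (by omega) ⟨(Units.mk0 y hy)⁻¹, fun d => ?_⟩
    have h1 := h ((τ ^ (m : ℤ)) d)
    rw [← RingAut.mul_apply, ← zpow_add, neg_add_cancel, zpow_zero, RingAut.one_apply] at h1
    rw [← zpow_natCast, inv_inv, Units.val_inv_eq_inv_val, Units.val_mk0, ← h1,
      mul_inv_cancel_right₀ hy]

/-- Take a nonzero element of the ideal with fewest nonzero coefficients and normalize it to `y`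
with constant coefficient `1`. For `d` in `D`, `d y - y d` has smaller support, hence vanishes. So
each coefficient intertwines the identity with `τ ^ n`, and `eq_zero_of_conj` leaves only `y = 1`.
-/
theorem isSimpleRing (hτ : HasInfiniteInnerOrder τ) : IsSimpleRing (SkewLaurent τ) := by
  refine ⟨⟨fun J => ?_⟩⟩
  by_cases hJ : J = ⊥
  · exact Or.inl hJ
  right
  obtain ⟨b, hb, hb0⟩ : ∃ b ∈ J, b ≠ 0 := by
    by_contra! h
    exact hJ (le_bot_iff.1 fun x hx => by simpa using h x hx)
  obtain ⟨x, ⟨hxJ, hx0⟩, hmin⟩ :=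
    (measure fun x : SkewLaurent τ => {n | x.coeff n ≠ 0}.ncard).wf.has_min
      {a | a ∈ J ∧ a ≠ 0} ⟨b, hb, hb0⟩
  obtain ⟨p, -, -, hp, -⟩ := exists_extremal hx0
  set y := monomial (-p) ((τ ^ (-p)) (x.coeff p)⁻¹) * x with hy
  have hyJ : y ∈ J := J.mul_mem_left _ _ hxJ
  have hy0 : y.coeff 0 = 1 := by
    rw [hy, coeff_normalize, zero_add, inv_mul_cancel₀ hp, map_one]
  have hcard : {n | y.coeff n ≠ 0}.ncard ≤ {n | x.coeff n ≠ 0}.ncard := by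
    refine Set.ncard_le_ncard_of_injOn (· + p) (fun n hn => ?_)
      (add_left_injective p).injOn x.finite_coeff_ne_zero
    intro h0
    apply hn
    rw [hy, coeff_normalize, h0, mul_zero, map_zero]
  have hcomm : ∀ (d : D) (n : ℤ), d * y.coeff n = y.coeff n * (τ ^ n) d := by
    intro d
    set z := monomial 0 d * y - y * monomial 0 d with hz
    have hzc : ∀ n, z.coeff n = d * y.coeff n - y.coeff n * (τ ^ n) d := by
      intro n
      rw [hz, coeff_sub, coeff_monomial_mul, coeff_mul_monomial]
      simp
    have hz0 : z = 0 := by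
      by_contra hne
      refine hmin z ⟨J.sub_mem (J.mul_mem_left _ _ hyJ) (J.mul_mem_right _ _ hyJ), hne⟩
        (lt_of_lt_of_le (Set.ncard_lt_ncard ?_ y.finite_coeff_ne_zero) hcard)
      refine (Set.ssubset_iff_of_subset ?_).2 ⟨0, by simp [hy0], by simp [hzc, hy0]⟩
      intro n hn h0
      apply hn
      rw [hzc, h0, mul_zero, zero_mul, sub_zero]
    intro n
    rw [← sub_eq_zero, ← hzc, hz0, coeff_zero]
  have hy1 : y = 1 := by
    refine ext_coeff fun n => ?_
    rw [coeff_one]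
    split_ifs with hn
    · rw [hn, hy0]
    · exact eq_zero_of_conj hτ hn fun d => hcomm d n
  rw [hy1] at hyJ
  exact (TwoSidedIdeal.one_mem_iff J).1 hyJ

/-- Every Sylvester rank function on `D[t^{±1}; τ]` takes the value one on nonzero elements. -/
theorem elementRank_eq_one (hτ : HasInfiniteInnerOrder τ) (r : SylvesterRank (SkewLaurent τ))
    (a : SkewLaurent τ) (ha : a ≠ 0) : r.elementRank a = 1 := by
  have := isSimpleRing hτ
  induction hN : a.width using Nat.strong_induction_on generalizing a with
  | _ N ih =>
  subst hN
  by_cases htop : Ideal.span {a} = ⊤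
  · obtain ⟨b, hb⟩ := Submodule.mem_span_singleton.1
      (show (1 : SkewLaurent τ) ∈ Ideal.span {a} by rw [htop]; trivial)
    exact r.elementRank_eq_one_of_left_inverse hb
  by_cases hmax : (Ideal.span {a}).IsMaximal
  · exact r.elementRank_eq_one_of_forall_cyclic (exists_cyclic_generator_of_isMaximal
      (fun a _ hb => exists_mul_eq_mul_of_isPrincipalIdealRing a hb) ha hmax)
  obtain ⟨J, haJ, hJ⟩ : ∃ J, Ideal.span {a} < J ∧ J ≠ ⊤ := by
    by_contra! h
    exact hmax ⟨htop, h⟩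
  obtain ⟨c, hc⟩ := IsPrincipalIdealRing.principal J
  obtain ⟨b, hb⟩ := Submodule.mem_span_singleton.1
    (show a ∈ Submodule.span _ {c} from hc ▸ haJ.le (Ideal.mem_span_singleton_self a))
  rw [smul_eq_mul] at hb
  have hc0 : c ≠ 0 := by
    rintro rfl
    exact ha (by rw [← hb, mul_zero])
  have hb0 : b ≠ 0 := by
    rintro rfl
    exact ha (by rw [← hb, zero_mul])
  have hw := width_add_width_le hb0 hc0
  rw [hb] at hw
  -- Neither factor is a unit: a unit `c` would give `J = R`, a unit `b` would give `J = R a`. Hence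
  -- both widths are at least two, and `width_add_width_le` makes both smaller than that of `a`.
  have hc1 : c.width ≠ 1 := by
    intro h
    obtain ⟨g, hg⟩ := exists_left_inverse_of_width_eq_one hc0 h
    refine hJ ((Ideal.eq_top_iff_one _).2 ?_)
    rw [hc]
    exact Submodule.mem_span_singleton.2 ⟨g, hg⟩
  have hb1 : b.width ≠ 1 := by
    intro h
    obtain ⟨g, hg⟩ := exists_left_inverse_of_width_eq_one hb0 h
    refine haJ.not_ge ?_
    rw [hc, Submodule.span_singleton_le_iff_mem]
    exact Submodule.mem_span_singleton.2 ⟨g, by rw [smul_eq_mul, ← hb, ← mul_assoc, hg, one_mul]⟩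
  obtain ⟨_, _, hbw, -⟩ := exists_extremal hb0
  obtain ⟨_, _, hcw, -⟩ := exists_extremal hc0
  rw [← hb]
  exact r.elementRank_mul_eq_one (ih b.width (by omega) b hb0 rfl)
    (ih c.width (by omega) c hc0 rfl)

end SkewLaurent

/-! ### Assembly -/

theorem mainTheorem8 {D : Type*} [DivisionRing D] (τ : RingAut D)
    (hτ : HasInfiniteInnerOrder τ) :
    -- the centre of `R = D[t^{±1}; τ]` is a field
    IsField (Subring.center (SkewLaurent τ)) ∧
    -- the Ore quotient ring `Q` of `R` exists
    Nonempty (OreLocalization.OreSet (nonZeroDivisors (SkewLaurent τ))) ∧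
    ∀ [OreLocalization.OreSet (nonZeroDivisors (SkewLaurent τ))],
      ∃ (rkQ : SylvesterRank (OreQuotient (SkewLaurent τ)))
        (rkR : SylvesterRank (SkewLaurent τ))
        (rkZ : SylvesterRank (Subring.center (SkewLaurent τ))),
        -- `Q` has exactly one rank function, the usual rank of matrices
        (∀ rk : SylvesterRank (OreQuotient (SkewLaurent τ)), rk = rkQ) ∧
        (∀ {m n : ℕ} (A : Matrix (Fin m) (Fin n) (OreQuotient (SkewLaurent τ))),
          rkQ.rk A = (rowRank A : ℝ)) ∧
        -- `R` has exactly one rank function, the one induced from `Q`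
        (∀ rk : SylvesterRank (SkewLaurent τ), rk = rkR) ∧
        rkR = rkQ.comap OreLocalization.numeratorRingHom ∧
        -- `Z(R)` has exactly one rank function, the usual rank, and that of `R` extends it
        (∀ rk : SylvesterRank (Subring.center (SkewLaurent τ)), rk = rkZ) ∧
        (∀ {m n : ℕ} (A : Matrix (Fin m) (Fin n) (Subring.center (SkewLaurent τ))),
          rkZ.rk A = (A.rank : ℝ)) ∧
        rkR.comap (Subring.center (SkewLaurent τ)).subtype = rkZ := by
  have := SkewLaurent.isSimpleRing hτ
  have hZ : IsField (Subring.center (SkewLaurent τ)) := IsSimpleRing.isField_center _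
  refine ⟨hZ, nonempty_oreSet_nonZeroDivisors, ?_⟩
  intro _
  let Q := OreQuotient (SkewLaurent τ)
  let φ : SkewLaurent τ →+* Q := OreLocalization.numeratorRingHom
  have hφ : Function.Injective φ := OreLocalization.numeratorHom_inj inf_le_left
  have hfrac : ∀ x : Q, ∃ s ≠ 0, ∃ a, φ s * x = φ a := by
    intro x
    induction x using OreLocalization.ind with | _ a s
    exact ⟨s, nonZeroDivisors.ne_zero s.2, a, OreLocalization.mul_cancel⟩
  let rkQ : SylvesterRank Q := SylvesterRank.ofDivisionRing Q
  -- The rank on the centre is defined by restriction, so the extension property is definitional;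
  -- that it is the usual rank follows from uniqueness over a field.
  refine ⟨rkQ, rkQ.comap φ, (rkQ.comap φ).comap (Subring.center (SkewLaurent τ)).subtype,
    fun rk => ?_, fun A => rfl, fun rk => ?_, rfl, fun rk => ?_, fun A => ?_, rfl⟩
  · ext m n A
    exact rk.rk_eq_rowRank A
  · ext m n A
    exact rk.rk_eq_rowRank_map φ hφ hfrac (SkewLaurent.elementRank_eq_one hτ rk) A
  · ext m n A
    rw [SylvesterRank.rk_eq_rank_of_isField hZ, SylvesterRank.rk_eq_rank_of_isField hZ]
  · exact SylvesterRank.rk_eq_rank_of_isField hZ _ A
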